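/- Let $\Gamma_n=\{P\in\mathbb R^n: p_i\ge 0,\ \sum_i p_i=1\}$ and $\Gamma_n^+=\{P\in\Gamma_n: p_i>0 \text{ for all } i\}$. Let $G:\Gamma_n\to\mathbb R$ be convex on $\Gamma_n$ and differentiable on $\Gamma_n^+$ (as a function on the simplex). The Bregman divergence generated by $G$ is $$D^G(P;Q)=G(P)-G(Q)-\langle\nabla G(Q),P-Q\rangle\in[0,+\infty],\qquad P,Q\in\Gamma_n,$$ where, for $Q$ on the boundary of $\Gamma_n$, $\langle\nabla G(Q),P-Q\rangle$ is read as the one-sided directional derivative $\lim_{t\downarrow0}\bigl(G(Q+t(P-Q))-G(Q)\bigr)/t\in[-\infty,\infty)$, which for $Q\in\Gamma_n^+$ equals the inner product. A function $D:\Gamma_n\times\Gamma_n\to[0,+\infty]$ satisfies Sufficiency if $D(P;Q)\ge D(PW;QW)$ for all $P,Q\in\Gamma_n$ and every stochastic $n\times n$ matrix $W$ which is a sufficient transformation for $(P,Q)$, meaning: if $Z\in\{1,2\}$ takes both values with positive probability, $X$ has conditional law $P$ given $Z=1$ and $Q$ given $Z=2$, and $Y$ is obtained from $X$ through the channel $W$,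 then $Z-X-Y$ and $Z-Y-X$ are both Markov chains. (Here $(PW)_y=\sum_x p_xW(y|x)$ is the law of the output.) 1. If $n\ge3$ and $D^G$ satisfies Sufficiency, then there is a constant $c\ge0$ with $D^G(P;Q)=c\,D_{\mathrm{KL}}(P;Q)$ for all $P,Q\in\Gamma_n$, where $D_{\mathrm{KL}}(P;Q)=\sum_i p_i\ln(p_i/q_i)$, with $0\ln 0=0$, with value $+\infty$ if $p_i>0=q_i$ for some $i$, and $0\cdot\infty=0$. ($D^G$ is not assumed to be decomposable.) 2. If $n=2$, then $D^G$ satisfies Sufficiency if and only if it is generated by a symmetric function, i.e. there is a convex $S:\Gamma_2\to\mathbb R$, differentiable on $\Gamma_2^+$, with $S(p_1,p_2)=S(p_2,p_1)$ on $\Gamma_2$, such that $D^G(P;Q)=D^S(P;Q)$ for all $P,Q\in\Gamma_2$. -/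

import Mathlib

open Set Filter Topology

/-- The probability simplex `Γ_n`: probability vectors on an alphabet with `n` letters. -/
abbrev probSimplex (n : ℕ) : Set (Fin n → ℝ) := stdSimplex ℝ (Fin n)

/-- The relative interior `Γ_n⁺` of the simplex: all probabilities are positive. -/
def probSimplexPos (n : ℕ) : Set (Fin n → ℝ) := {P | P ∈ probSimplex n ∧ ∀ i, 0 < P i}

/-! ### Sufficient transformations -/

/-- `A - B - C` is a Markov chain under the joint mass function `μ` on `α × β × γ`:
`A` and `C` are conditionally independent given `B`, i.e.
`μ(a,b,c) μ(b) = μ(a,b) μ(b,c)` for all `a, b, c`. -/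
def IsMarkovChain {α β γ : Type} [Fintype α] [Fintype β] [Fintype γ]
    (μ : α → β → γ → ℝ) : Prop :=
  ∀ a b c, μ a b c * (∑ a', ∑ c', μ a' b c') = (∑ c', μ a b c') * (∑ a', μ a' b c)

/-- The joint mass function of `(Z, X, Y)`, where `Z ∈ {1, 2}` has law `w`, the conditional laws
of `X` given `Z = 1` and `Z = 2` are `P` and `Q`, and `Y` is produced from `X` by the channel `W`
(so `W x y` is the conditional probability of `Y = y` given `X = x`). -/
def jointZXY {n : ℕ} (w : Fin 2 → ℝ) (P Q : Fin n → ℝ) (W : Matrix (Fin n) (Fin n) ℝ)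
    (z : Fin 2) (x y : Fin n) : ℝ :=
  w z * (![P, Q] z) x * W x y

/-- The channel `W` is a sufficient transformation of `X` for `Z`: both `Z - X - Y` and
`Z - Y - X` are Markov chains. -/
def IsSufficientTransformation {n : ℕ} (w : Fin 2 → ℝ) (P Q : Fin n → ℝ)
    (W : Matrix (Fin n) (Fin n) ℝ) : Prop :=
  IsMarkovChain (fun z x y => jointZXY w P Q W z x y) ∧
    IsMarkovChain (fun z y x => jointZXY w P Q W z x y)

/-- The sufficiency property of a divergence function on `Γ_n`. The law `w` of `Z` charges both
values of `Z`, so that the conditional laws given `Z` are meaningful; `Matrix.vecMul P W` is the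
output law of the channel `W` (a row-stochastic matrix) with input law `P`. -/
def SatisfiesSufficiency (n : ℕ) (D : (Fin n → ℝ) → (Fin n → ℝ) → EReal) : Prop :=
  ∀ P ∈ probSimplex n, ∀ Q ∈ probSimplex n, ∀ w ∈ probSimplexPos 2,
    ∀ W ∈ Matrix.rowStochastic ℝ (Fin n), IsSufficientTransformation w P Q W →
      D (Matrix.vecMul P W) (Matrix.vecMul Q W) ≤ D P Q

/-! ### Bregman divergences -/

/-- `G` generates a Bregman divergence on `Γ_n`: it is convex on `Γ_n` and differentiable on
`Γ_n⁺` (as a function on the simplex; values of `G` off the simplex play no role). -/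
structure IsBregmanGenerator (n : ℕ) (G : (Fin n → ℝ) → ℝ) : Prop where
  convexOn : ConvexOn ℝ (probSimplex n) G
  differentiable : ∀ Q ∈ probSimplexPos n, DifferentiableWithinAt ℝ G (probSimplex n) Q

/-- The one-sided directional derivative of `G` at `Q` in the direction `P - Q`, with values in
the extended reals. For convex `G` the difference quotients do converge as `t ↓ 0`
(`tendsto_dirDeriv`), so the upper limit below is a limit; it is `⟨∇G(Q), P - Q⟩` at every point
`Q` where `G` is differentiable, and it may be `-∞` at boundary points `Q`. -/
noncomputable def dirDeriv {n : ℕ} (G : (Fin n → ℝ) → ℝ) (Q P : Fin n → ℝ) : EReal :=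
  limsup (fun t : ℝ => (((G (Q + t • (P - Q)) - G Q) / t : ℝ) : EReal)) (𝓝[>] 0)

/-- The Bregman divergence `D^G(P;Q) = G(P) - G(Q) - ⟨∇G(Q), P - Q⟩` generated by `G`, on all of
`Γ_n × Γ_n`; see `bregman_eq` for the points where `G` is differentiable. -/
noncomputable def bregman {n : ℕ} (G : (Fin n → ℝ) → ℝ) (P Q : Fin n → ℝ) : EReal :=
  ((G P - G Q : ℝ) : EReal) - dirDeriv G Q P

/-- `G` is a symmetric function on `Γ_n`: invariant under permutations of the coordinates. -/
def IsSymmetricOnSimplex (n : ℕ) (G : (Fin n → ℝ) → ℝ) : Prop :=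
  ∀ σ : Equiv.Perm (Fin n), ∀ P ∈ probSimplex n, G (P ∘ σ) = G P

/-- Kullback-Leibler divergence `∑ p_i ln (p_i / q_i)`, which is `+∞` unless `P ≪ Q`
(with `0 ln 0 = 0`). -/
noncomputable def klDivergence {n : ℕ} (P Q : Fin n → ℝ) : EReal :=
  open Classical in
  if ∀ i, Q i = 0 → P i = 0 then ((∑ i, P i * Real.log (P i / Q i) : ℝ) : EReal) else ⊤

/-! ### Consistency of the definitions -/

theorem tendsto_dirDeriv {n : ℕ} {G : (Fin n → ℝ) → ℝ} (hG : ConvexOn ℝ (probSimplex n) G)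
    {P Q : Fin n → ℝ} (hP : P ∈ probSimplex n) (hQ : Q ∈ probSimplex n) :
    Tendsto (fun t : ℝ => (((G (Q + t • (P - Q)) - G Q) / t : ℝ) : EReal)) (𝓝[>] 0)
      (𝓝 (dirDeriv G Q P)) := by
  set f : ℝ → EReal := fun t => (((G (Q + t • (P - Q)) - G Q) / t : ℝ) : EReal) with hf
  have hmem : ∀ t ∈ Icc (0 : ℝ) 1, Q + t • (P - Q) ∈ probSimplex n := by
    intro t ht
    exact (convex_stdSimplex ℝ (Fin n)).add_smul_sub_mem hQ hP ht
  have hmono : MonotoneOn f (Ioc 0 1) := by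
    intro s hs t ht hst
    simp only [hf, EReal.coe_le_coe_iff]
    rw [div_le_div_iff₀ hs.1 ht.1]
    have hst' : s / t ≤ 1 := (div_le_one ht.1).2 hst
    have h := hG.2 hQ (hmem t ⟨ht.1.le, ht.2⟩) (show (0 : ℝ) ≤ 1 - s / t by linarith)
      (div_nonneg hs.1.le ht.1.le) (by ring)
    have he : (1 - s / t) • Q + (s / t) • (Q + t • (P - Q)) = Q + s • (P - Q) := by
      ext i
      have := ht.1.ne'
      simp only [Pi.add_apply, Pi.smul_apply, Pi.sub_apply, smul_eq_mul]
      field_simp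
      ring
    rw [he] at h
    simp only [smul_eq_mul] at h
    have h2 := mul_le_mul_of_nonneg_right h ht.1.le
    have h3 : ((1 - s / t) * G Q + s / t * G (Q + t • (P - Q))) * t
        = (t - s) * G Q + s * G (Q + t • (P - Q)) := by
      have := ht.1.ne'
      field_simp
    rw [h3] at h2
    nlinarith
  have hlim : Tendsto f (𝓝[>] 0) (𝓝 (sInf (f '' Ioo 0 1))) :=
    (hmono.mono Ioo_subset_Ioc_self).tendsto_nhdsWithin_Ioo_right (by simp) (OrderBot.bddBelow _)
  have : dirDeriv G Q P = sInf (f '' Ioo 0 1) := hlim.limsup_eq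
  rw [this]
  exact hlim

theorem bregman_eq {n : ℕ} {G : (Fin n → ℝ) → ℝ} {P Q : Fin n → ℝ} {G' : (Fin n → ℝ) →L[ℝ] ℝ}
    (hP : P ∈ probSimplex n) (hQ : Q ∈ probSimplex n)
    (hG : HasFDerivWithinAt G G' (probSimplex n) Q) :
    bregman G P Q = ((G P - G Q - G' (P - Q) : ℝ) : EReal) := by
  have hlim : Tendsto (fun t : ℝ => (G (Q + t • (P - Q)) - G Q) / t) (𝓝[>] 0)
      (𝓝 (G' (P - Q))) := by
    have hc : HasDerivWithinAt (fun t : ℝ => Q + t • (P - Q)) (P - Q) (Icc 0 1) 0 := by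
      have := ((hasDerivAt_id (0 : ℝ)).smul_const (P - Q)).const_add Q
      simpa using this.hasDerivWithinAt
    have hmaps : MapsTo (fun t : ℝ => Q + t • (P - Q)) (Icc 0 1) (probSimplex n) :=
      fun t ht => (convex_stdSimplex ℝ (Fin n)).add_smul_sub_mem hQ hP ht
    have hG0 : HasFDerivWithinAt G G' (probSimplex n) (Q + (0 : ℝ) • (P - Q)) := by simpa using hG
    have h := (hG0.comp_hasDerivWithinAt (0 : ℝ) hc hmaps).mono Ioc_subset_Icc_self
    rw [hasDerivWithinAt_iff_tendsto_slope' (by simp)] at h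
    rw [← nhdsWithin_Ioc_eq_nhdsGT (zero_lt_one (α := ℝ))]
    refine h.congr fun t => ?_
    simp [slope_def_field]
  have : dirDeriv G Q P = ((G' (P - Q) : ℝ) : EReal) :=
    ((continuous_coe_real_ereal.tendsto _).comp hlim).limsup_eq
  rw [bregman, this, ← EReal.coe_sub]

/-- The law on the alphabet `Fin n` with probability vector `P`, as a measure. -/
noncomputable def lawOf {n : ℕ} (P : Fin n → ℝ) : MeasureTheory.Measure (Fin n) :=
  ∑ i, ENNReal.ofReal (P i) • MeasureTheory.Measure.dirac i

theorem lawOf_singleton {n : ℕ} (P : Fin n → ℝ) (i : Fin n) :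
    lawOf P {i} = ENNReal.ofReal (P i) := by
  simp only [lawOf, MeasureTheory.Measure.finsetSum_apply, MeasureTheory.Measure.smul_apply,
    MeasureTheory.Measure.dirac_apply, smul_eq_mul]
  rw [Finset.sum_eq_single i] <;> simp +contextual [Set.indicator]

/-- The finite formula agrees with the Kullback-Leibler divergence of measures. -/
theorem klDivergence_eq_klDiv {n : ℕ} {P Q : Fin n → ℝ}
    (hP : P ∈ probSimplex n) (hQ : Q ∈ probSimplex n) :
    klDivergence P Q = (InformationTheory.klDiv (lawOf P) (lawOf Q) : EReal) := by
  have hprob : ∀ {R : Fin n → ℝ}, R ∈ probSimplex n →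
      MeasureTheory.IsProbabilityMeasure (lawOf R) := by
    intro R hR
    constructor
    simp only [lawOf, MeasureTheory.Measure.finsetSum_apply, MeasureTheory.Measure.smul_apply,
      MeasureTheory.measure_univ, smul_eq_mul, mul_one]
    rw [← ENNReal.ofReal_sum_of_nonneg fun i _ => hR.1 i, hR.2, ENNReal.ofReal_one]
  have := hprob hP
  have := hprob hQ
  have hac : (lawOf P).AbsolutelyContinuous (lawOf Q) ↔ ∀ i, Q i = 0 → P i = 0 := by
    constructor
    · intro h i hi
      have := h (s := {i}) (by simp [lawOf_singleton, hi])
      rw [lawOf_singleton, ENNReal.ofReal_eq_zero] at this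
      exact le_antisymm this (hP.1 i)
    · intro h s hs
      rw [← Set.biUnion_of_singleton s, MeasureTheory.measure_biUnion_null_iff s.to_countable]
      intro i hi
      have hi0 : lawOf Q {i} = 0 :=
        MeasureTheory.measure_mono_null (Set.singleton_subset_iff.2 hi) hs
      rw [lawOf_singleton, ENNReal.ofReal_eq_zero] at hi0 ⊢
      exact (h i (le_antisymm hi0 (hQ.1 i))).le
  by_cases h : ∀ i, Q i = 0 → P i = 0
  · have hμν := hac.2 h
    have hint : MeasureTheory.Integrable (MeasureTheory.llr (lawOf P) (lawOf Q)) (lawOf P) :=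
      MeasureTheory.Integrable.of_finite
    have hrn : ∀ i, P i ≠ 0 → (lawOf P).rnDeriv (lawOf Q) i = ENNReal.ofReal (P i / Q i) := by
      intro i hi
      have hQi : 0 < Q i := lt_of_le_of_ne (hQ.1 i) fun h0 => hi (h i h0.symm)
      have h1 := MeasureTheory.Measure.setLIntegral_rnDeriv hμν {i}
      rw [MeasureTheory.lintegral_singleton, lawOf_singleton, lawOf_singleton] at h1
      rw [ENNReal.ofReal_div_of_pos hQi, ← h1, ENNReal.mul_div_cancel_right] <;> simp [hQi]
    have hsum : ∫ x, MeasureTheory.llr (lawOf P) (lawOf Q) x ∂(lawOf P)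
        = ∑ i, P i * Real.log (P i / Q i) := by
      rw [MeasureTheory.integral_fintype hint]
      refine Finset.sum_congr rfl fun i _ => ?_
      rw [MeasureTheory.measureReal_def, lawOf_singleton, ENNReal.toReal_ofReal (hP.1 i),
        smul_eq_mul]
      by_cases hi : P i = 0
      · simp [hi]
      · rw [MeasureTheory.llr, hrn i hi,
          ENNReal.toReal_ofReal (div_nonneg (hP.1 i) (hQ.1 i))]
    have hnn := InformationTheory.integral_llr_add_sub_measure_univ_nonneg hμν hint
    rw [klDivergence, if_pos h, InformationTheory.klDiv_of_ac_of_integrable hμν hint, hsum]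
    rw [hsum] at hnn
    simp only [MeasureTheory.probReal_univ, add_sub_cancel_right] at hnn ⊢
    rw [EReal.coe_ennreal_ofReal, max_eq_left hnn]
  · rw [klDivergence, if_neg h, InformationTheory.klDiv_of_not_ac fun h' => h (hac.1 h'),
      EReal.coe_ennreal_top]

/-!
A channel is sufficient for `P` and `Q` exactly when it never merges letters with different
likelihood ratios.

On two letters, if `P ≠ Q` then a sufficient channel merges nothing and so is a permutation.
Sufficiency therefore says that `D^G` is invariant under permutations, that is, that averaging `G`
over the permutations of the letters does not change the divergence.

On `n ≥ 3` letters, let `P` and `R` have disjoint supports. Whatever `P` and `R` are, there are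
sufficient channels from `(P, q P + (1 - q) R)` to any other such pair with the same `q` and back,
so `D^G(P; q P + (1 - q) R) = ψ(q)` depends on `q` only. In particular `D^G(e_i; Q) = ψ(q_i)`, and,
`D^G(P; Q)` being affine in `P` up to a term `G(P)` free of `Q`, nonnegativity of the divergence
says that the score `-ψ(q_i)` for forecasting `Q` when letter `i` is observed is proper. A proper
score that depends only on the probability of the observed letter is logarithmic,
`ψ(q) = C - c ln q`: propriety makes `ψ` monotone, hence differentiable somewhere, and carries
differentiability from one point `p` to every other point `b`, with `p ψ'(p) = b ψ'(b)`.
Consequently `G` is `c ∑ p_i ln p_i` plus an affine function in the interior up to the constant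
`C`, and exactly so on the boundary. The divergence between two points of a boundary segment,
computed in both ways, gives `C = 0`.
-/

section BregmanCalculus

variable {n : ℕ} {G H : (Fin n → ℝ) → ℝ} {P Q : Fin n → ℝ}

theorem dirDeriv_le (hG : ConvexOn ℝ (probSimplex n) G) (hP : P ∈ probSimplex n)
    (hQ : Q ∈ probSimplex n) : dirDeriv G Q P ≤ ((G P - G Q : ℝ) : EReal) := by
  refine le_of_tendsto (tendsto_dirDeriv hG hP hQ) ?_
  filter_upwards [Ioc_mem_nhdsGT one_pos] with t ht
  rw [EReal.coe_le_coe_iff, div_le_iff₀ ht.1]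
  have hconv := hG.2 hQ hP (sub_nonneg.2 ht.2) ht.1.le (sub_add_cancel 1 t)
  rw [show (1 - t) • Q + t • P = Q + t • (P - Q) by module] at hconv
  simp only [smul_eq_mul] at hconv
  linarith

theorem dirDeriv_ne_top (hG : ConvexOn ℝ (probSimplex n) G) (hP : P ∈ probSimplex n)
    (hQ : Q ∈ probSimplex n) : dirDeriv G Q P ≠ ⊤ :=
  ne_top_of_le_ne_top (EReal.coe_ne_top _) (dirDeriv_le hG hP hQ)

theorem bregman_nonneg (hG : ConvexOn ℝ (probSimplex n) G) (hP : P ∈ probSimplex n)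
    (hQ : Q ∈ probSimplex n) : 0 ≤ bregman G P Q :=
  (EReal.sub_nonneg (.inl (EReal.coe_ne_top _)) (.inl (EReal.coe_ne_bot _))).2
    (dirDeriv_le hG hP hQ)

theorem bregman_self (G : (Fin n → ℝ) → ℝ) (P : Fin n → ℝ) : bregman G P P = 0 := by
  simp [bregman, dirDeriv]

theorem bregman_zero (P Q : Fin n → ℝ) : bregman 0 P Q = 0 := by
  simp [bregman, dirDeriv]

theorem bregman_continuousLinearMap (L : (Fin n → ℝ) →L[ℝ] ℝ) (hP : P ∈ probSimplex n)
    (hQ : Q ∈ probSimplex n) : bregman L P Q = 0 := by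
  rw [bregman_eq hP hQ L.hasFDerivWithinAt, map_sub, sub_self, EReal.coe_zero]

theorem bregman_congr (h : EqOn G H (segment ℝ Q P)) : bregman G P Q = bregman H P Q := by
  have hdir : dirDeriv G Q P = dirDeriv H Q P := by
    refine limsup_congr ?_
    filter_upwards [Ioc_mem_nhdsGT one_pos] with t ht
    have hmem : Q + t • (P - Q) ∈ segment ℝ Q P := by
      rw [segment_eq_image']
      exact mem_image_of_mem _ (Ioc_subset_Icc_self ht)
    rw [h hmem, h (left_mem_segment ℝ Q P)]
  rw [bregman, bregman, hdir, h (left_mem_segment ℝ Q P), h (right_mem_segment ℝ Q P)]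

theorem bregman_smul {c : ℝ} (hc : 0 ≤ c) (G : (Fin n → ℝ) → ℝ) (P Q : Fin n → ℝ) :
    bregman (c • G) P Q = c * bregman G P Q := by
  have hdir : dirDeriv (c • G) Q P = c * dirDeriv G Q P := by
    rw [dirDeriv, dirDeriv, ← EReal.limsup_const_mul_of_nonneg_of_ne_top
      (EReal.coe_nonneg.2 hc) (EReal.coe_ne_top c)]
    refine limsup_congr (Eventually.of_forall fun t => ?_)
    rw [← EReal.coe_mul, Pi.smul_apply, Pi.smul_apply, ← smul_sub, smul_eq_mul, mul_div_assoc]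
  rw [bregman, bregman, hdir, Pi.smul_apply, Pi.smul_apply, ← smul_sub, smul_eq_mul, EReal.coe_mul,
    sub_eq_add_neg _ (dirDeriv G Q P),
    EReal.left_distrib_of_nonneg_of_ne_top (EReal.coe_nonneg.2 hc) (EReal.coe_ne_top c), mul_neg,
    ← sub_eq_add_neg]

theorem bregman_add (hG : ConvexOn ℝ (probSimplex n) G) (hH : ConvexOn ℝ (probSimplex n) H)
    (hP : P ∈ probSimplex n) (hQ : Q ∈ probSimplex n) :
    bregman (G + H) P Q = bregman G P Q + bregman H P Q := by
  have hG' := dirDeriv_ne_top hG hP hQ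
  have hH' := dirDeriv_ne_top hH hP hQ
  have hdir : dirDeriv (G + H) Q P = dirDeriv G Q P + dirDeriv H Q P := by
    refine tendsto_nhds_unique (tendsto_dirDeriv (hG.add hH) hP hQ) ?_
    refine ((EReal.continuousAt_add (.inl hG') (.inr hH')).tendsto.comp
      ((tendsto_dirDeriv hG hP hQ).prodMk_nhds (tendsto_dirDeriv hH hP hQ))).congr fun t => ?_
    rw [Function.comp_apply, ← EReal.coe_add, Pi.add_apply, Pi.add_apply, add_sub_add_comm,
      add_div]
  rw [bregman, hdir, Pi.add_apply, Pi.add_apply, add_sub_add_comm, EReal.coe_add,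
    EReal.add_sub_add_comm (.inr hH') (.inl hG'), bregman, bregman]

variable {ι : Type*} {F : ι → (Fin n → ℝ) → ℝ}

theorem convexOn_sum {E : Type*} [AddCommGroup E] [Module ℝ E] {K : Set E} {f : ι → E → ℝ}
    (hK : Convex ℝ K) (hf : ∀ i, ConvexOn ℝ K (f i)) (s : Finset ι) :
    ConvexOn ℝ K (∑ i ∈ s, f i) :=
  Finset.sum_induction _ (ConvexOn ℝ K) (fun _ _ => ConvexOn.add) (convexOn_const 0 hK)
    fun i _ => hf i

theorem bregman_sum (hF : ∀ i, ConvexOn ℝ (probSimplex n) (F i)) (hP : P ∈ probSimplex n)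
    (hQ : Q ∈ probSimplex n) (s : Finset ι) :
    bregman (∑ i ∈ s, F i) P Q = ∑ i ∈ s, bregman (F i) P Q := by
  induction s using Finset.cons_induction with
  | empty => exact bregman_zero P Q
  | cons i s hi ih =>
    rw [Finset.sum_cons, Finset.sum_cons, ← ih,
      bregman_add (hF i) (convexOn_sum (convex_stdSimplex ℝ (Fin n)) hF s) hP hQ]

end BregmanCalculus

section NegEntropy

variable {n : ℕ} {P Q : Fin n → ℝ}

/-- The negative Shannon entropy `∑ p_i ln p_i`, the generator of the Kullback-Leibler
divergence; `0 ln 0 = 0` holds because `Real.log 0 = 0`. -/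
noncomputable def negEntropy (P : Fin n → ℝ) : ℝ := ∑ i, P i * Real.log (P i)

theorem negEntropy_eq_sum :
    (negEntropy : (Fin n → ℝ) → ℝ) = ∑ i, fun P : Fin n → ℝ => P i * Real.log (P i) := by
  ext P
  simp only [negEntropy, Finset.sum_apply]

theorem convexOn_coord_mul_log (i : Fin n) :
    ConvexOn ℝ (probSimplex n) fun P : Fin n → ℝ => P i * Real.log (P i) :=
  (Real.convexOn_mul_log.comp_linearMap (LinearMap.proj (φ := fun _ : Fin n => ℝ) i)).subset
    (fun _ hP => hP.1 i) (convex_stdSimplex ℝ (Fin n))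

theorem convexOn_negEntropy : ConvexOn ℝ (probSimplex n) negEntropy := by
  rw [negEntropy_eq_sum]
  exact convexOn_sum (convex_stdSimplex ℝ (Fin n)) convexOn_coord_mul_log Finset.univ

theorem bregman_coord_mul_log (hP : P ∈ probSimplex n) (hQ : Q ∈ probSimplex n) {i : Fin n}
    (hPQ : Q i = 0 → P i = 0) :
    bregman (fun R => R i * Real.log (R i)) P Q
      = ((P i * Real.log (P i / Q i) - (P i - Q i) : ℝ) : EReal) := by
  by_cases hQi : Q i = 0
  · have hzero : EqOn (fun R : Fin n → ℝ => R i * Real.log (R i)) 0 (segment ℝ Q P) := by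
      rintro R ⟨a, b, -, -, -, rfl⟩
      simp [hQi, hPQ hQi]
    rw [bregman_congr hzero, bregman_zero, hQi, hPQ hQi]
    simp
  · have hcoord : HasFDerivAt (fun R : Fin n → ℝ => R i)
        (ContinuousLinearMap.proj i : (Fin n → ℝ) →L[ℝ] ℝ) Q := hasFDerivAt_apply i Q
    have hderiv := (Real.hasDerivAt_mul_log hQi).comp_hasFDerivAt Q hcoord
    refine (bregman_eq hP hQ hderiv.hasFDerivWithinAt).trans (EReal.coe_eq_coe_iff.2 ?_)
    simp only [Function.comp_apply, smul_apply, ContinuousLinearMap.proj_apply, Pi.sub_apply,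
      smul_eq_mul]
    by_cases hPi : P i = 0
    · simp only [hPi, zero_mul]
      ring
    · rw [Real.log_div hPi hQi]
      ring

theorem bregman_coord_mul_log_eq_top {i : Fin n} (hPi : 0 < P i) (hQi : Q i = 0) :
    bregman (fun R => R i * Real.log (R i)) P Q = ⊤ := by
  have hlog : Tendsto (fun t : ℝ => P i * (Real.log t + Real.log (P i))) (𝓝[>] 0) atBot :=
    (tendsto_atBot_add_const_right _ _ Real.tendsto_log_nhdsGT_zero).const_mul_atBot hPi
  have hquot : (fun t : ℝ => P i * (Real.log t + Real.log (P i))) =ᶠ[𝓝[>] 0] fun t =>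
      ((Q + t • (P - Q)) i * Real.log ((Q + t • (P - Q)) i) - Q i * Real.log (Q i)) / t := by
    filter_upwards [self_mem_nhdsWithin] with t ht
    have ht0 : t ≠ 0 := (mem_Ioi.1 ht).ne'
    simp only [Pi.add_apply, Pi.smul_apply, Pi.sub_apply, smul_eq_mul, hQi, sub_zero, zero_add,
      zero_mul]
    rw [Real.log_mul ht0 hPi.ne', mul_assoc, mul_div_cancel_left₀ _ ht0]
  have hdir : dirDeriv (fun R : Fin n → ℝ => R i * Real.log (R i)) Q P = ⊥ :=
    (EReal.tendsto_coe_nhds_bot_iff.2 (hlog.congr' hquot)).limsup_eq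
  rw [bregman, hdir, EReal.coe_sub_bot]

theorem klDivergence_single {i : Fin n} (hQi : Q i ≠ 0) :
    klDivergence (Pi.single i 1) Q = ((-Real.log (Q i) : ℝ) : EReal) := by
  have hac : ∀ k, Q k = 0 → (Pi.single i 1 : Fin n → ℝ) k = 0 := fun k hk =>
    Pi.single_eq_of_ne (by rintro rfl; exact hQi hk) 1
  rw [klDivergence, if_pos hac, Fintype.sum_eq_single i fun k hk => ?_]
  · rw [Pi.single_eq_same, one_mul, one_div, Real.log_inv]
  · rw [Pi.single_eq_of_ne hk, zero_mul]

theorem bregman_negEntropy (hP : P ∈ probSimplex n) (hQ : Q ∈ probSimplex n) :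
    bregman negEntropy P Q = klDivergence P Q := by
  rw [negEntropy_eq_sum, bregman_sum convexOn_coord_mul_log hP hQ]
  by_cases hac : ∀ i, Q i = 0 → P i = 0
  · rw [klDivergence, if_pos hac,
      Finset.sum_congr rfl fun i _ => bregman_coord_mul_log hP hQ (hac i)]
    let coe : ℝ →+ EReal := ⟨⟨Real.toEReal, EReal.coe_zero⟩, EReal.coe_add⟩
    refine (map_sum coe _ _).symm.trans (congrArg coe ?_)
    rw [Finset.sum_sub_distrib, Finset.sum_sub_distrib, hP.2, hQ.2, sub_self, sub_zero]
  · rw [klDivergence, if_neg hac]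
    push Not at hac
    obtain ⟨k, hQk, hPk⟩ := hac
    rw [eq_top_iff, ← bregman_coord_mul_log_eq_top ((hP.1 k).lt_of_ne' hPk) hQk]
    exact Finset.single_le_sum (f := fun i => bregman (fun R => R i * Real.log (R i)) P Q)
      (fun i _ => bregman_nonneg (convexOn_coord_mul_log i) hP hQ) (Finset.mem_univ k)

theorem bregman_eq_mul_klDivergence {G : (Fin n → ℝ) → ℝ} {L : (Fin n → ℝ) →L[ℝ] ℝ} {c : ℝ}
    (hc : 0 ≤ c) (hP : P ∈ probSimplex n) (hQ : Q ∈ probSimplex n)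
    (hG : EqOn G (⇑L + c • negEntropy) (segment ℝ Q P)) :
    bregman G P Q = c * klDivergence P Q := by
  rw [bregman_congr hG, bregman_add (G := L) (H := c • negEntropy)
    (L.toLinearMap.convexOn (convex_stdSimplex ℝ (Fin n)))
    (convexOn_negEntropy.smul hc) hP hQ, bregman_continuousLinearMap L hP hQ, zero_add,
    bregman_smul hc, bregman_negEntropy hP hQ]

end NegEntropy

section Sufficiency

variable {n : ℕ} {P Q : Fin n → ℝ} {W : Matrix (Fin n) (Fin n) ℝ}

theorem vecMul_mem_probSimplex (hP : P ∈ probSimplex n) (hW : W ∈ Matrix.rowStochastic ℝ (Fin n)) :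
    Matrix.vecMul P W ∈ probSimplex n := by
  refine ⟨fun y => Matrix.nonneg_vecMul_of_mem_rowStochastic hW hP.1 y, ?_⟩
  rw [← dotProduct_one]
  exact Matrix.vecMul_dotProduct_one_eq_one_rowStochastic hW ((dotProduct_one P).trans hP.2)

theorem vecMul_eq_of_forall_ne_zero {V : Fin n → ℝ} (hP : P ∈ probSimplex n)
    (h : ∀ x, P x ≠ 0 → W x = V) : Matrix.vecMul P W = V := by
  ext y
  have hterm : ∀ x, P x * W x y = P x * V y := fun x => by
    by_cases hx : P x = 0
    · rw [hx, zero_mul, zero_mul]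
    · rw [h x hx]
  rw [Matrix.vecMul, dotProduct, Finset.sum_congr rfl fun x _ => hterm x, ← Finset.sum_mul, hP.2,
    one_mul]

theorem comp_perm_mem_probSimplex (hP : P ∈ probSimplex n) (σ : Equiv.Perm (Fin n)) :
    P ∘ σ ∈ probSimplex n :=
  ⟨fun i => hP.1 (σ i), (Equiv.sum_comp σ P).trans hP.2⟩

theorem isSufficientTransformation_iff_posterior {w : Fin 2 → ℝ} (hw : ∀ z, w z ≠ 0) :
    IsSufficientTransformation w P Q W ↔
      ∀ x y, P x * W x y * Matrix.vecMul Q W y = Q x * W x y * Matrix.vecMul P W y := by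
  have hmarginal : ∀ (c : ℝ) (R : Fin n → ℝ) (y : Fin n),
      ∑ x, c * R x * W x y = c * Matrix.vecMul R W y := fun c R y => by
    simp only [Matrix.vecMul, dotProduct, Finset.mul_sum, mul_assoc]
  constructor
  · rintro ⟨-, hZYX⟩ x y
    have h := hZYX 0 y x
    simp only [jointZXY, Fin.sum_univ_two, Matrix.cons_val_zero, Matrix.cons_val_one,
      hmarginal] at h
    refine mul_left_cancel₀ (mul_ne_zero (hw 0) (hw 1)) ?_
    linear_combination h
  · intro h
    constructor
    · intro z x y
      simp only [jointZXY, ← Finset.mul_sum, Fin.sum_univ_two]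
      ring
    · refine Fin.forall_fin_two.2 ⟨fun y x => ?_, fun y x => ?_⟩ <;>
        simp only [jointZXY, Fin.sum_univ_two, Matrix.cons_val_zero, Matrix.cons_val_one, hmarginal]
      · linear_combination w 0 * w 1 * h x y
      · linear_combination -(w 0 * w 1) * h x y

theorem isSufficientTransformation_iff {w : Fin 2 → ℝ} (hw : ∀ z, w z ≠ 0) (hP : 0 ≤ P)
    (hQ : 0 ≤ Q) (hW : ∀ x y, 0 ≤ W x y) :
    IsSufficientTransformation w P Q W ↔
      ∀ x x' y, W x y ≠ 0 → W x' y ≠ 0 → P x * Q x' = P x' * Q x := by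
  rw [isSufficientTransformation_iff_posterior hw]
  constructor
  · intro h x x' y hx hx'
    have hpost : ∀ z, W z y ≠ 0 → P z * Matrix.vecMul Q W y = Q z * Matrix.vecMul P W y :=
      fun z hz => mul_left_cancel₀ hz (by linear_combination h z y)
    have hnull : ∀ {R : Fin n → ℝ}, 0 ≤ R → Matrix.vecMul R W y = 0 → R x = 0 := by
      intro R hR h0
      have hterm := (Finset.sum_eq_zero_iff_of_nonneg fun z _ => mul_nonneg (hR z) (hW z y)).1
        (show ∑ z, R z * W z y = 0 from h0)
      exact (mul_eq_zero.1 (hterm x (Finset.mem_univ x))).resolve_right hx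
    by_cases hQ0 : Matrix.vecMul Q W y = 0
    · by_cases hP0 : Matrix.vecMul P W y = 0
      · rw [hnull hP hP0, hnull hQ hQ0, zero_mul, mul_zero]
      · refine mul_left_cancel₀ hP0 ?_
        linear_combination P x' * hpost x hx - P x * hpost x' hx'
    · refine mul_left_cancel₀ hQ0 ?_
      linear_combination Q x' * hpost x hx - Q x * hpost x' hx'
  · intro h x y
    simp only [Matrix.vecMul, dotProduct, Finset.mul_sum]
    refine Finset.sum_congr rfl fun x' _ => ?_
    by_cases hx : W x y = 0
    · simp only [hx, mul_zero, zero_mul]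
    by_cases hx' : W x' y = 0
    · simp only [hx', mul_zero]
    linear_combination W x y * W x' y * h x x' y hx hx'

namespace SatisfiesSufficiency

variable {D : (Fin n → ℝ) → (Fin n → ℝ) → EReal}

theorem vecMul_le (hD : SatisfiesSufficiency n D) (hP : P ∈ probSimplex n) (hQ : Q ∈ probSimplex n)
    (hW : W ∈ Matrix.rowStochastic ℝ (Fin n))
    (h : ∀ x x' y, W x y ≠ 0 → W x' y ≠ 0 → P x * Q x' = P x' * Q x) :
    D (Matrix.vecMul P W) (Matrix.vecMul Q W) ≤ D P Q := by
  have hw : (fun _ => 1 / 2 : Fin 2 → ℝ) ∈ probSimplexPos 2 :=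
    ⟨⟨fun _ => by norm_num, by norm_num⟩, fun _ => by norm_num⟩
  exact hD P hP Q hQ _ hw W hW ((isSufficientTransformation_iff (fun z => (hw.2 z).ne') hP.1 hQ.1
    fun _ _ => Matrix.nonneg_of_mem_rowStochastic hW).2 h)

theorem comp_perm (hD : SatisfiesSufficiency n D) (hP : P ∈ probSimplex n)
    (hQ : Q ∈ probSimplex n) (σ : Equiv.Perm (Fin n)) : D (P ∘ σ) (Q ∘ σ) = D P Q := by
  have hle : ∀ (τ : Equiv.Perm (Fin n)) {P Q : Fin n → ℝ}, P ∈ probSimplex n →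
      Q ∈ probSimplex n → D (P ∘ τ) (Q ∘ τ) ≤ D P Q := by
    intro τ P Q hP hQ
    have hsub : ∀ x y, (τ⁻¹).permMatrix ℝ x y ≠ 0 → x = τ y := by
      intro x y hxy
      by_contra hne
      exact hxy (if_neg fun h => hne (by simpa [Equiv.symm_apply_eq] using h))
    have hτ := hD.vecMul_le hP hQ (Matrix.permMatrix_mem_rowStochastic (σ := τ⁻¹))
      fun x x' y hx hx' => by rw [hsub x y hx, hsub x' y hx']
    simpa only [Matrix.vecMul_permMatrix, Equiv.Perm.inv_def, Equiv.symm_symm] using hτ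
  refine (hle σ hP hQ).antisymm ?_
  simpa only [Function.comp_assoc, Equiv.self_comp_symm, Function.comp_id] using
    hle σ.symm (comp_perm_mem_probSimplex hP σ) (comp_perm_mem_probSimplex hQ σ)

theorem mixture_le (hD : SatisfiesSufficiency n D) {P R P' R' : Fin n → ℝ}
    (hP : P ∈ probSimplex n) (hR : R ∈ probSimplex n) (hPR : ∀ x, P x = 0 ∨ R x = 0)
    (hP' : P' ∈ probSimplex n) (hR' : R' ∈ probSimplex n) (hPR' : ∀ x, P' x = 0 ∨ R' x = 0)
    {q : ℝ} (hq : q ∈ Icc (0 : ℝ) 1) :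
    D P' (q • P' + (1 - q) • R') ≤ D P (q • P + (1 - q) • R) := by
  classical
  -- The channel reveals which of `P` and `R` its input came from and nothing else.
  let W : Matrix (Fin n) (Fin n) ℝ := Matrix.of fun x => if R x = 0 then P' else R'
  have hWrow : ∀ x, W x = if R x = 0 then P' else R' := fun _ => rfl
  have hW : W ∈ Matrix.rowStochastic ℝ (Fin n) := by
    refine Matrix.mem_rowStochastic_iff_sum.2 ⟨fun x y => ?_, fun x => ?_⟩ <;>
      rw [hWrow] <;> split_ifs
    exacts [hP'.1 y, hR'.1 y, hP'.2, hR'.2]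
  have hPW : Matrix.vecMul P W = P' :=
    vecMul_eq_of_forall_ne_zero hP fun x hx => if_pos ((hPR x).resolve_left hx)
  have hRW : Matrix.vecMul R W = R' := vecMul_eq_of_forall_ne_zero hR fun x hx => if_neg hx
  have hmix : q • P + (1 - q) • R ∈ probSimplex n :=
    convex_stdSimplex ℝ (Fin n) hP hR hq.1 (sub_nonneg.2 hq.2) (add_sub_cancel q 1)
  have hle := hD.vecMul_le hP hmix hW fun x x' y hx hx' => ?_
  · rwa [Matrix.add_vecMul, Matrix.smul_vecMul, Matrix.smul_vecMul, hPW, hRW] at hle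
  · suffices P x * R x' = P x' * R x by
      simp only [Pi.add_apply, Pi.smul_apply, smul_eq_mul]
      linear_combination (1 - q) * this
    rw [hWrow] at hx hx'
    grind

theorem mixture_eq (hD : SatisfiesSufficiency n D) {P R P' R' : Fin n → ℝ}
    (hP : P ∈ probSimplex n) (hR : R ∈ probSimplex n) (hPR : ∀ x, P x = 0 ∨ R x = 0)
    (hP' : P' ∈ probSimplex n) (hR' : R' ∈ probSimplex n) (hPR' : ∀ x, P' x = 0 ∨ R' x = 0)
    {q : ℝ} (hq : q ∈ Icc (0 : ℝ) 1) :
    D P (q • P + (1 - q) • R) = D P' (q • P' + (1 - q) • R') :=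
  (hD.mixture_le hP' hR' hPR' hP hR hPR hq).antisymm (hD.mixture_le hP hR hPR hP' hR' hPR' hq)

end SatisfiesSufficiency

end Sufficiency

section Symmetrization

variable {n : ℕ} {G S : (Fin n → ℝ) → ℝ} {P Q : Fin n → ℝ}

theorem IsSymmetricOnSimplex.bregman_comp_perm (hS : IsSymmetricOnSimplex n S)
    (hP : P ∈ probSimplex n) (hQ : Q ∈ probSimplex n) (σ : Equiv.Perm (Fin n)) :
    bregman S (P ∘ σ) (Q ∘ σ) = bregman S P Q :=
  bregman_congr (G := fun R => S (R ∘ σ)) fun R hR =>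
    hS σ R ((convex_stdSimplex ℝ (Fin n)).segment_subset hQ hP hR)

/-- The average of `G` over all permutations of the letters, which turns a generator of a
permutation invariant Bregman divergence into a symmetric one. -/
noncomputable def symmetrization (G : (Fin n → ℝ) → ℝ) : (Fin n → ℝ) → ℝ :=
  (Fintype.card (Equiv.Perm (Fin n)) : ℝ)⁻¹ • ∑ σ : Equiv.Perm (Fin n), fun P => G (P ∘ σ)

theorem isSymmetricOnSimplex_symmetrization (G : (Fin n → ℝ) → ℝ) :
    IsSymmetricOnSimplex n (symmetrization G) := by
  intro τ P _
  simp only [symmetrization, Pi.smul_apply, Finset.sum_apply, Function.comp_assoc]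
  congr 1
  exact Equiv.sum_comp (Equiv.mulLeft τ) fun σ => G (P ∘ σ)

theorem convexOn_comp_perm (hG : ConvexOn ℝ (probSimplex n) G) (σ : Equiv.Perm (Fin n)) :
    ConvexOn ℝ (probSimplex n) fun P => G (P ∘ σ) :=
  (hG.comp_linearMap (LinearMap.funLeft ℝ ℝ σ)).subset
    (fun _ hP => comp_perm_mem_probSimplex hP σ) (convex_stdSimplex ℝ (Fin n))

theorem IsBregmanGenerator.symmetrization (hG : IsBregmanGenerator n G) :
    IsBregmanGenerator n (symmetrization G) where
  convexOn := (convexOn_sum (convex_stdSimplex ℝ (Fin n)) (convexOn_comp_perm hG.convexOn)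
    Finset.univ).smul (by positivity)
  differentiable Q hQ := by
    refine DifferentiableWithinAt.const_smul (DifferentiableWithinAt.sum fun σ _ => ?_) _
    have hcomp : DifferentiableWithinAt ℝ (fun P : Fin n → ℝ => P ∘ σ) (probSimplex n) Q := by
      fun_prop
    exact (hG.differentiable (Q ∘ σ) ⟨comp_perm_mem_probSimplex hQ.1 σ, fun i => hQ.2 (σ i)⟩).comp
      Q hcomp fun P hP => comp_perm_mem_probSimplex hP σ

theorem bregman_symmetrization (hG : ConvexOn ℝ (probSimplex n) G)
    (hD : SatisfiesSufficiency n (bregman G)) (hP : P ∈ probSimplex n) (hQ : Q ∈ probSimplex n) :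
    bregman (symmetrization G) P Q = bregman G P Q := by
  have hinv : ∀ σ : Equiv.Perm (Fin n), bregman (fun R => G (R ∘ σ)) P Q = bregman G P Q :=
    fun σ => hD.comp_perm hP hQ σ
  rw [symmetrization, bregman_smul (by positivity), bregman_sum (convexOn_comp_perm hG) hP hQ,
    Finset.sum_congr rfl fun σ _ => hinv σ, Finset.sum_const, Finset.card_univ, EReal.nsmul_eq_mul,
    ← mul_assoc, ← EReal.coe_natCast, ← EReal.coe_mul,
    inv_mul_cancel₀ (Nat.cast_ne_zero.2 Fintype.card_ne_zero), EReal.coe_one, one_mul]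

theorem exists_eq_permMatrix_of_mem_rowStochastic {ι : Type*} [Fintype ι] [DecidableEq ι]
    {W : Matrix ι ι ℝ} (hW : W ∈ Matrix.rowStochastic ℝ ι)
    (h : ∀ x x' y, W x y ≠ 0 → W x' y ≠ 0 → x = x') :
    ∃ σ : Equiv.Perm ι, W = σ.permMatrix ℝ := by
  have hrow : ∀ x, ∃ y, W x y ≠ 0 := fun x => by
    by_contra! h0
    simpa [h0] using Matrix.sum_row_of_mem_rowStochastic hW x
  choose f hf using hrow
  have hinj : Function.Injective f := fun x x' hxx' => h x x' (f x) (hf x) (hxx' ▸ hf x')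
  have hzero : ∀ x y, f x ≠ y → W x y = 0 := fun x y hne => by
    obtain ⟨x', rfl⟩ := Finite.surjective_of_injective hinj y
    by_contra hxy
    exact hne (congrArg f (h x x' _ hxy (hf x')))
  have hone : ∀ x, W x (f x) = 1 := fun x => by
    rw [← Matrix.sum_row_of_mem_rowStochastic hW x]
    exact (Finset.sum_eq_single_of_mem _ (Finset.mem_univ _) fun y _ hy => hzero x y hy.symm).symm
  refine ⟨Equiv.ofBijective f (Finite.injective_iff_bijective.1 hinj), ?_⟩
  ext x y
  rw [Equiv.Perm.permMatrix, PEquiv.toMatrix_toPEquiv_apply, Equiv.ofBijective_apply]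
  by_cases hxy : f x = y
  · rw [← hxy, hone, Pi.single_eq_same]
  · rw [hzero x y hxy, Pi.single_eq_of_ne' hxy]

theorem IsSymmetricOnSimplex.satisfiesSufficiency_two {S : (Fin 2 → ℝ) → ℝ}
    (hS : IsSymmetricOnSimplex 2 S) : SatisfiesSufficiency 2 (bregman S) := by
  intro P hP Q hQ w hw W hW hsuff
  rw [isSufficientTransformation_iff (fun z => (hw.2 z).ne') hP.1 hQ.1
    fun _ _ => Matrix.nonneg_of_mem_rowStochastic hW] at hsuff
  by_cases hPQ : P = Q
  · subst hPQ
    rw [bregman_self, bregman_self]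
  have hratio : P 0 * Q 1 ≠ P 1 * Q 0 := fun h => by
    have hP1 := hP.2
    have hQ1 := hQ.2
    rw [Fin.sum_univ_two] at hP1 hQ1
    have h0 : P 0 = Q 0 := by linear_combination h - P 0 * hQ1 + Q 0 * hP1
    exact hPQ (funext (Fin.forall_fin_two.2 ⟨h0, by linarith⟩))
  have hinj : ∀ x x' y, W x y ≠ 0 → W x' y ≠ 0 → x = x' := by
    intro x x' y hx hx'
    have h := hsuff x x' y hx hx'
    fin_cases x <;> fin_cases x'
    exacts [rfl, absurd h hratio, absurd h.symm hratio, rfl]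
  obtain ⟨σ, rfl⟩ := exists_eq_permMatrix_of_mem_rowStochastic hW hinj
  rw [Matrix.vecMul_permMatrix, Matrix.vecMul_permMatrix, hS.bregman_comp_perm hP hQ]

theorem satisfiesSufficiency_two_iff {G : (Fin 2 → ℝ) → ℝ} (hG : IsBregmanGenerator 2 G) :
    SatisfiesSufficiency 2 (bregman G) ↔
      ∃ S : (Fin 2 → ℝ) → ℝ, IsBregmanGenerator 2 S ∧ IsSymmetricOnSimplex 2 S ∧
        ∀ P ∈ probSimplex 2, ∀ Q ∈ probSimplex 2, bregman G P Q = bregman S P Q := by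
  constructor
  · intro hD
    exact ⟨symmetrization G, hG.symmetrization, isSymmetricOnSimplex_symmetrization G,
      fun P hP Q hQ => (bregman_symmetrization hG.convexOn hD hP hQ).symm⟩
  · rintro ⟨S, -, hsymm, hGS⟩ P hP Q hQ w hw W hW hsuff
    rw [hGS P hP Q hQ, hGS _ (vecMul_mem_probSimplex hP hW) _ (vecMul_mem_probSimplex hQ hW)]
    exact hsymm.satisfiesSufficiency_two P hP Q hQ w hw W hW hsuff

end Symmetrization

section ScoringRules

/-- The score `-ψ`, applied to the probability assigned to the observed letter, is proper as far as
forecasts are concerned that differ in two letters only: no reported pair `(q, q')` beats the true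
pair `(p, p')` in expectation. -/
def IsBinaryProper (ψ : ℝ → ℝ) : Prop :=
  ∀ ⦃p p' q q' : ℝ⦄, 0 < p → 0 < p' → 0 < q → 0 < q' → p + p' = q + q' → p + p' < 1 →
    0 ≤ p * (ψ q - ψ p) + p' * (ψ q' - ψ p')

theorem exists_differentiableAt_of_antitoneOn {f : ℝ → ℝ} {a b : ℝ}
    (hf : AntitoneOn f (Ioo a b)) (hab : a < b) : ∃ x ∈ Ioo a b, DifferentiableAt ℝ f x := by
  by_contra! hnot
  have hnull : MeasureTheory.volume (Ioo a b) = 0 := by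
    have hae := hf.neg.ae_differentiableWithinAt_of_mem
    refine MeasureTheory.measure_mono_null ?_ hae
    intro x hx hdiff
    refine hnot x hx ?_
    simpa using ((hdiff hx).differentiableAt (Ioo_mem_nhds hx.1 hx.2)).neg
  rw [Real.volume_Ioo, ENNReal.ofReal_eq_zero] at hnull
  linarith

theorem hasDerivAt_of_squeeze {f g h : ℝ → ℝ} {d x : ℝ} (hf : HasDerivAt f d x)
    (hh : HasDerivAt h d x) (hfg : f ≤ᶠ[𝓝 x] g) (hgh : g ≤ᶠ[𝓝 x] h) (hfh : f x = h x) :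
    HasDerivAt g d x := by
  have hgf : g x = f x := (hgh.self_of_nhds.trans hfh.ge).antisymm hfg.self_of_nhds
  rw [hasDerivAt_iff_isLittleO] at hf hh ⊢
  refine (Asymptotics.IsBigO.of_bound' ?_).trans_isLittleO (hf.norm_left.add hh.norm_left)
  filter_upwards [hfg, hgh] with y hfy hhy
  rw [Real.norm_of_nonneg (add_nonneg (norm_nonneg _) (norm_nonneg _)), hgf]
  refine (abs_le_max_abs_abs ?_ ?_).trans (max_le_add_of_nonneg (abs_nonneg _) (abs_nonneg _))
  · gcongr
  · rw [← hfh]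
    gcongr

namespace IsBinaryProper

variable {ψ : ℝ → ℝ}

theorem antitoneOn (hψ : IsBinaryProper ψ) : AntitoneOn ψ (Ioo 0 1) := by
  intro q hq p hp hqp
  rcases hqp.eq_or_lt with rfl | hlt
  · exact le_rfl
  have hp1 := hp.2
  obtain ⟨p', hp'⟩ : ∃ p', p' = (1 - p) / 2 := ⟨_, rfl⟩
  obtain ⟨q', hq'⟩ : ∃ q', q' = p + p' - q := ⟨_, rfl⟩
  have hp'0 : 0 < p' := by linarith
  have hq'0 : p' < q' := by linarith
  have htrue_p := hψ hp.1 hp'0 hq.1 (hp'0.trans hq'0) (by linarith) (by linarith)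
  have htrue_q := hψ hq.1 (hp'0.trans hq'0) hp.1 hp'0 (by linarith) (by linarith)
  have hcomb : 0 ≤ (p * q' - p' * q) * (ψ q - ψ p) := by
    have hsum := add_nonneg (mul_nonneg (hp'0.trans hq'0).le htrue_p)
      (mul_nonneg hp'0.le htrue_q)
    linear_combination hsum
  have hdet : 0 < p * q' - p' * q := by
    have := mul_lt_mul'' hlt hq'0 hq.1.le hp'0.le
    linarith
  exact sub_nonneg.1 (nonneg_of_mul_nonneg_right hcomb hdet)

-- Propriety at `(p, b)` and at `(p + b - x, x)` traps `ψ` near `b` between two functions of the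
-- reflection `x ↦ ψ (p + b - x)`, both with derivative `p * d / b` at `b`.
theorem hasDerivAt_of_hasDerivAt (hψ : IsBinaryProper ψ) {p b d : ℝ} (hp : 0 < p) (hb : 0 < b)
    (hpb : p + b < 1) (hd : HasDerivAt ψ d p) : HasDerivAt ψ (p * d / b) b := by
  have hrefl : HasDerivAt (fun x => ψ (p + b - x) - ψ p) (-d) b := by
    have hd' : HasDerivAt ψ d (p + b - b) := by simpa using hd
    exact ((hd'.comp_const_sub (p + b) b)).sub_const (ψ p)
  have hlower : HasDerivAt (fun x => ψ b + -(p / b) * (ψ (p + b - x) - ψ p)) (p * d / b) b :=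
    ((hrefl.const_mul (-(p / b))).const_add (ψ b)).congr_deriv (by ring)
  have hupper : HasDerivAt (fun x => ψ b + -((p + b - x) / x) * (ψ (p + b - x) - ψ p))
      (p * d / b) b := by
    have hratio : HasDerivAt (fun x => -((p + b - x) / x)) _ b :=
      (((hasDerivAt_id b).const_sub (p + b)).div (hasDerivAt_id b) hb.ne').neg
    refine ((hratio.mul hrefl).const_add (ψ b)).congr_deriv ?_
    rw [add_sub_cancel_right, sub_self]
    ring
  have hnear : ∀ᶠ x in 𝓝 b, x ∈ Ioo 0 (p + b) := Ioo_mem_nhds hb (by linarith)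
  refine hasDerivAt_of_squeeze hlower hupper ?_ ?_ (by simp)
  · filter_upwards [hnear] with x hx
    have htrue := hψ hp hb (sub_pos.2 hx.2) hx.1 (by ring) hpb
    rw [← le_sub_iff_add_le', neg_mul, neg_le, div_mul_eq_mul_div, le_div_iff₀ hb]
    linarith
  · filter_upwards [hnear] with x hx
    have htrue := hψ (sub_pos.2 hx.2) hx.1 hp hb (by ring) (by linarith)
    rw [← sub_le_iff_le_add', neg_mul, le_neg, div_mul_eq_mul_div, div_le_iff₀ hx.1]
    linarith

theorem exists_hasDerivAt (hψ : IsBinaryProper ψ) :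
    ∃ k : ℝ, ∀ b ∈ Ioo (0 : ℝ) 1, HasDerivAt ψ (k / b) b := by
  have hdiff : ∀ ε ∈ Ioc (0 : ℝ) 1, ∃ p ∈ Ioo 0 ε, DifferentiableAt ℝ ψ p := fun ε hε =>
    exists_differentiableAt_of_antitoneOn (hψ.antitoneOn.mono (Ioo_subset_Ioo_right hε.2)) hε.1
  obtain ⟨p₀, ⟨hp₀, hp₀'⟩, -⟩ := hdiff (1 / 2) (by norm_num)
  refine ⟨p₀ * deriv ψ p₀, fun b hb => ?_⟩
  obtain ⟨p, ⟨hp, hp'⟩, hd⟩ := hdiff (min (1 - b) (1 / 2))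
    ⟨lt_min (sub_pos.2 hb.2) (by norm_num), (min_le_right _ _).trans (by norm_num)⟩
  rw [lt_min_iff] at hp'
  have hp₀d : deriv ψ p₀ = p * deriv ψ p / p₀ :=
    (hψ.hasDerivAt_of_hasDerivAt hp hp₀ (by linarith) hd.hasDerivAt).deriv
  rw [hp₀d, mul_div_cancel₀ _ hp₀.ne']
  exact hψ.hasDerivAt_of_hasDerivAt hp hb.1 (by linarith) hd.hasDerivAt

theorem exists_eq_log (hψ : IsBinaryProper ψ) :
    ∃ c C : ℝ, 0 ≤ c ∧ ∀ p ∈ Ioo (0 : ℝ) 1, ψ p = C - c * Real.log p := by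
  obtain ⟨k, hk⟩ := hψ.exists_hasDerivAt
  have hderiv : ∀ b ∈ Ioo (0 : ℝ) 1, HasDerivAt (fun x => ψ x - k * Real.log x) 0 b := fun b hb =>
    ((hk b hb).sub ((Real.hasDerivAt_log hb.1.ne').const_mul k)).congr_deriv
      (by rw [div_eq_mul_inv, sub_self])
  obtain ⟨C, hC⟩ := isOpen_Ioo.exists_is_const_of_deriv_eq_zero isPreconnected_Ioo
    (fun b hb => (hderiv b hb).differentiableAt.differentiableWithinAt)
    (fun b hb => (hderiv b hb).deriv)
  have hlog : ∀ p ∈ Ioo (0 : ℝ) 1, ψ p = C - -k * Real.log p := fun p hp => by linarith [hC p hp]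
  refine ⟨-k, C, ?_, hlog⟩
  have hquarter : (1 / 4 : ℝ) ∈ Ioo (0 : ℝ) 1 := by norm_num
  have hhalf : (1 / 2 : ℝ) ∈ Ioo (0 : ℝ) 1 := by norm_num
  have hanti := hψ.antitoneOn hquarter hhalf (by norm_num)
  rw [hlog _ hquarter, hlog _ hhalf] at hanti
  have hlt : Real.log (1 / 4) < Real.log (1 / 2) := Real.log_lt_log (by norm_num) (by norm_num)
  exact nonneg_of_mul_nonneg_left (by linarith) (sub_pos.2 hlt)

end IsBinaryProper

end ScoringRules

section MixtureProfile

theorem exists_mem_stdSimplex_eq_zero_iff {ι : Type*} [Fintype ι] {A : Set ι} (hA : A ≠ univ) :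
    ∃ R ∈ stdSimplex ℝ ι, ∀ i, R i = 0 ↔ i ∈ A := by
  classical
  obtain ⟨k, hk⟩ := (ne_univ_iff_exists_notMem A).1 hA
  have hcard : (0 : ℝ) < ({i | i ∉ A} : Finset ι).card :=
    Nat.cast_pos.2 (Finset.card_pos.2 ⟨k, by simpa using hk⟩)
  refine ⟨fun i => if i ∈ A then 0 else (({i | i ∉ A} : Finset ι).card : ℝ)⁻¹,
    ⟨fun i => ?_, ?_⟩, fun i => ?_⟩
  · dsimp only
    split_ifs <;> positivity
  · rw [Finset.sum_ite, Finset.sum_const_zero, zero_add, Finset.sum_const, nsmul_eq_mul,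
      mul_inv_cancel₀ hcard.ne']
  · simp [hcard.ne']

variable {n : ℕ} {G : (Fin n → ℝ) → ℝ} {D : (Fin n → ℝ) → (Fin n → ℝ) → EReal} {P Q R : Fin n → ℝ}
  {ψ : ℝ → ℝ} {c C : ℝ}

theorem mem_Ioo_of_mem_probSimplexPos (hn : 2 ≤ n) (hQ : Q ∈ probSimplexPos n) (i : Fin n) :
    Q i ∈ Ioo (0 : ℝ) 1 := by
  have : Nontrivial (Fin n) := Fin.nontrivial_iff_two_le.2 hn
  obtain ⟨j, hji⟩ := exists_ne i
  refine ⟨hQ.2 i, ?_⟩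
  rw [← hQ.1.2]
  exact Finset.single_lt_sum hji (Finset.mem_univ i) (Finset.mem_univ j) (hQ.2 j)
    fun k _ _ => (hQ.2 k).le

theorem exists_eq_single_add_of_lt_one (hQ : Q ∈ probSimplex n) {i : Fin n} (hi : Q i < 1) :
    ∃ R ∈ probSimplex n, R i = 0 ∧ Q = Q i • Pi.single i 1 + (1 - Q i) • R := by
  have hpos : 0 < 1 - Q i := sub_pos.2 hi
  refine ⟨(1 - Q i)⁻¹ • (Q - Q i • Pi.single i 1), ⟨fun j => ?_, ?_⟩, ?_, ?_⟩
  · refine mul_nonneg (inv_nonneg.2 hpos.le) ?_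
    rcases eq_or_ne j i with rfl | hji
    · simp
    · simpa [hji] using hQ.1 j
  · simp only [Pi.smul_apply, Pi.sub_apply, smul_eq_mul, ← Finset.mul_sum, Finset.sum_sub_distrib,
      hQ.2, Finset.sum_pi_single', Finset.mem_univ, if_true, mul_one]
    simp [hpos.ne']
  · simp
  · rw [smul_inv_smul₀ hpos.ne', add_sub_cancel]

theorem mixture_mem_probSimplexPos (hP : P ∈ probSimplex n) (hR : R ∈ probSimplex n)
    (hPR : ∀ i, P i ≠ 0 ∨ R i ≠ 0) {q : ℝ} (hq : q ∈ Ioo (0 : ℝ) 1) :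
    q • P + (1 - q) • R ∈ probSimplexPos n := by
  have hq' : 0 < 1 - q := sub_pos.2 hq.2
  refine ⟨convex_stdSimplex ℝ (Fin n) hP hR hq.1.le hq'.le (add_sub_cancel q 1), fun i => ?_⟩
  rcases hPR i with hi | hi
  · exact add_pos_of_pos_of_nonneg (mul_pos hq.1 ((hP.1 i).lt_of_ne' hi))
      (mul_nonneg hq'.le (hR.1 i))
  · exact add_pos_of_nonneg_of_pos (mul_nonneg hq.1.le (hP.1 i))
      (mul_pos hq' ((hR.1 i).lt_of_ne' hi))

theorem single_add_single_add_mem_probSimplexPos {i j : Fin n} (hR : R ∈ probSimplex n)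
    (hRij : ∀ k, R k = 0 → k ∈ ({i, j} : Set (Fin n))) {p p' : ℝ} (hp : 0 < p) (hp' : 0 < p')
    (hpp' : p + p' < 1) :
    Pi.single i p + Pi.single j p' + (1 - (p + p')) • R ∈ probSimplexPos n := by
  have hpos : 0 < 1 - (p + p') := sub_pos.2 hpp'
  have hi : ∀ k, 0 ≤ (Pi.single i p : Fin n → ℝ) k :=
    show (0 : Fin n → ℝ) ≤ _ from Pi.single_nonneg.2 hp.le
  have hj : ∀ k, 0 ≤ (Pi.single j p' : Fin n → ℝ) k :=
    show (0 : Fin n → ℝ) ≤ _ from Pi.single_nonneg.2 hp'.le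
  have hcoord : ∀ k, 0 < (Pi.single i p + Pi.single j p' + (1 - (p + p')) • R : Fin n → ℝ) k := by
    intro k
    have hk := mul_nonneg hpos.le (hR.1 k)
    simp only [Pi.add_apply, Pi.smul_apply, smul_eq_mul]
    by_cases hRk : R k = 0
    · rcases hRij k hRk with rfl | rfl
      · rw [Pi.single_eq_same]
        linarith [hj k]
      · rw [Pi.single_eq_same]
        linarith [hi k]
    · have := mul_pos hpos ((hR.1 k).lt_of_ne' hRk)
      linarith [hi k, hj k]
  refine ⟨⟨fun k => (hcoord k).le, ?_⟩, hcoord⟩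
  simp only [Pi.add_apply, Pi.smul_apply, smul_eq_mul, Finset.sum_add_distrib,
    ← Finset.mul_sum, hR.2, Finset.sum_pi_single', Finset.mem_univ, if_true]
  ring

/-- The affine function on the simplex with the same values at the vertices as `G`, extended to a
linear function. A Bregman divergence determines its generator up to such a function. -/
noncomputable def vertexInterpolation (G : (Fin n → ℝ) → ℝ) : (Fin n → ℝ) →L[ℝ] ℝ :=
  ∑ i, G (Pi.single i 1) • ContinuousLinearMap.proj i

theorem vertexInterpolation_apply (G : (Fin n → ℝ) → ℝ) (P : Fin n → ℝ) :
    vertexInterpolation G P = ∑ i, P i * G (Pi.single i 1) := by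
  simp only [vertexInterpolation, sum_apply, smul_apply, ContinuousLinearMap.proj_apply,
    smul_eq_mul, mul_comm]

theorem bregman_eq_of_bregman_single_eq {d : Fin n → ℝ} (hP : P ∈ probSimplex n)
    (hQ : Q ∈ probSimplex n) (hG : DifferentiableWithinAt ℝ G (probSimplex n) Q)
    (hd : ∀ i, bregman G (Pi.single i 1) Q = d i) :
    bregman G P Q = ((G P - vertexInterpolation G P + ∑ i, P i * d i : ℝ) : EReal) := by
  obtain ⟨G', hG'⟩ := hG
  have hvertex : ∀ i, d i = G (Pi.single i 1) - G Q - (G' (Pi.single i 1) - G' Q) := fun i => by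
    have h := (hd i).symm.trans (bregman_eq (single_mem_stdSimplex ℝ i) hQ hG')
    rw [← map_sub]
    exact_mod_cast h
  have hG'P : G' P = ∑ i, P i * G' (Pi.single i 1) := by
    conv_lhs => rw [pi_eq_sum_univ' P, map_sum]
    simp only [map_smul, smul_eq_mul]
  have hsum : ∑ i, P i * d i = vertexInterpolation G P - G Q - (G' P - G' Q) := by
    simp only [hvertex, mul_sub, Finset.sum_sub_distrib, ← Finset.sum_mul, hP.2, one_mul,
      vertexInterpolation_apply, hG'P]
  rw [bregman_eq hP hQ hG', map_sub, hsum]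
  congr 1
  ring

/-- `ψ` describes `D` on pairs consisting of a law and one of its mixtures with a law of disjoint
support: such a divergence is `ψ q`, where `q` is the weight of the law in the mixture. -/
def IsMixtureProfile (n : ℕ) (D : (Fin n → ℝ) → (Fin n → ℝ) → EReal) (ψ : ℝ → ℝ) : Prop :=
  ∀ P ∈ probSimplex n, ∀ R ∈ probSimplex n, (∀ x, P x = 0 ∨ R x = 0) →
    ∀ q ∈ Ioo (0 : ℝ) 1, D P (q • P + (1 - q) • R) = ψ q

theorem exists_isMixtureProfile (hn : 2 ≤ n) (hG : IsBregmanGenerator n G)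
    (hD : SatisfiesSufficiency n (bregman G)) : ∃ ψ, IsMixtureProfile n (bregman G) ψ := by
  have : Nontrivial (Fin n) := Fin.nontrivial_iff_two_le.2 hn
  obtain ⟨i, j, hij⟩ := exists_pair_ne (Fin n)
  have hE : Pi.single i 1 ∈ probSimplex n := single_mem_stdSimplex ℝ i
  obtain ⟨R, hR, hRi⟩ := exists_mem_stdSimplex_eq_zero_iff (A := {i})
    ((ne_univ_iff_exists_notMem _).2 ⟨j, hij.symm⟩)
  have hER : ∀ x, (Pi.single i 1 : Fin n → ℝ) x = 0 ∨ R x = 0 := fun x =>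
    (eq_or_ne x i).symm.imp (fun hx => Pi.single_eq_of_ne hx 1) (hRi x).2
  have hER' : ∀ x, (Pi.single i 1 : Fin n → ℝ) x ≠ 0 ∨ R x ≠ 0 := fun x =>
    (eq_or_ne x i).imp (fun hx => by simp [hx]) fun hx => mt (hRi x).1 hx
  have hreal : ∀ q ∈ Ioo (0 : ℝ) 1, ∃ r : ℝ,
      bregman G (Pi.single i 1) (q • Pi.single i 1 + (1 - q) • R) = r := fun q hq => by
    have hQ := mixture_mem_probSimplexPos hE hR hER' hq
    obtain ⟨G', hG'⟩ := hG.differentiable _ hQ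
    exact ⟨_, bregman_eq hE hQ.1 hG'⟩
  choose! ψ hψ using hreal
  exact ⟨ψ, fun P hP S hS hPS q hq =>
    (hD.mixture_eq hP hS hPS hE hR hER (Ioo_subset_Icc_self hq)).trans (hψ q hq)⟩

namespace IsMixtureProfile

theorem apply_single (hψ : IsMixtureProfile n D ψ) (hQ : Q ∈ probSimplex n) {i : Fin n}
    (hi : Q i ∈ Ioo (0 : ℝ) 1) : D (Pi.single i 1) Q = ψ (Q i) := by
  obtain ⟨R, hR, hRi, hQR⟩ := exists_eq_single_add_of_lt_one hQ hi.2
  have hdisj : ∀ x, (Pi.single i 1 : Fin n → ℝ) x = 0 ∨ R x = 0 := fun x =>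
    (eq_or_ne x i).symm.imp (fun hx => Pi.single_eq_of_ne hx 1) (by rintro rfl; exact hRi)
  rw [← hψ _ (single_mem_stdSimplex ℝ i) R hR hdisj _ hi, ← hQR]

theorem bregman_apply (hψ : IsMixtureProfile n (bregman G) ψ) (hn : 2 ≤ n)
    (hG : IsBregmanGenerator n G) (hP : P ∈ probSimplex n) (hQ : Q ∈ probSimplexPos n) :
    bregman G P Q = ((G P - vertexInterpolation G P + ∑ i, P i * ψ (Q i) : ℝ) : EReal) :=
  bregman_eq_of_bregman_single_eq hP hQ.1 (hG.differentiable Q hQ) fun i =>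
    hψ.apply_single hQ.1 (mem_Ioo_of_mem_probSimplexPos hn hQ i)

theorem eq_vertexInterpolation_sub (hψ : IsMixtureProfile n (bregman G) ψ) (hn : 2 ≤ n)
    (hG : IsBregmanGenerator n G) (hQ : Q ∈ probSimplexPos n) :
    G Q = vertexInterpolation G Q - ∑ i, Q i * ψ (Q i) := by
  have h := (hψ.bregman_apply hn hG hQ.1 hQ).symm.trans (bregman_self G Q)
  rw [EReal.coe_eq_zero] at h
  linarith

theorem isBinaryProper (hψ : IsMixtureProfile n (bregman G) ψ) (hn : 3 ≤ n)
    (hG : IsBregmanGenerator n G) : IsBinaryProper ψ := by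
  intro p p' q q' hp hp' hq hq' hsum hlt
  obtain ⟨i, j, k, hij, hik, hjk⟩ := Fintype.two_lt_card_iff.1
    (show 2 < Fintype.card (Fin n) by rwa [Fintype.card_fin])
  obtain ⟨R, hR, hRij⟩ := exists_mem_stdSimplex_eq_zero_iff (A := {i, j})
    ((ne_univ_iff_exists_notMem _).2 ⟨k, by simp [hik.symm, hjk.symm]⟩)
  have hRij' : ∀ x, R x = 0 → x ∈ ({i, j} : Set (Fin n)) := fun x => (hRij x).1
  have hP := single_add_single_add_mem_probSimplexPos hR hRij' hp hp' hlt
  have hQ := single_add_single_add_mem_probSimplexPos hR hRij' hq hq' (hsum ▸ hlt)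
  set P := Pi.single i p + Pi.single j p' + (1 - (p + p')) • R with hPdef
  set Q := Pi.single i q + Pi.single j q' + (1 - (q + q')) • R with hQdef
  have hRi : R i = 0 := (hRij i).2 (by simp)
  have hRj : R j = 0 := (hRij j).2 (by simp)
  have hPi : P i = p := by simp [hPdef, hij, hRi]
  have hPj : P j = p' := by simp [hPdef, hij.symm, hRj]
  have hQi : Q i = q := by simp [hQdef, hij, hRi]
  have hQj : Q j = q' := by simp [hQdef, hij.symm, hRj]
  have hrest : ∀ x, x ≠ i ∧ x ≠ j → P x * (ψ (Q x) - ψ (P x)) = 0 := fun x hx => by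
    have hPQ : Q x = P x := by simp [hPdef, hQdef, hx.1, hx.2, hsum]
    rw [hPQ, sub_self, mul_zero]
  have hnonneg := bregman_nonneg hG.convexOn hP.1 hQ.1
  rw [hψ.bregman_apply (by lia) hG hP.1 hQ, EReal.coe_nonneg,
    hψ.eq_vertexInterpolation_sub (by lia) hG hP, sub_right_comm, sub_self, zero_sub,
    neg_add_eq_sub, ← Finset.sum_sub_distrib] at hnonneg
  simp only [← mul_sub] at hnonneg
  rwa [Fintype.sum_eq_add i j hij hrest, hPi, hPj, hQi, hQj] at hnonneg

theorem exists_log (hψ : IsMixtureProfile n (bregman G) ψ) (hn : 3 ≤ n)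
    (hG : IsBregmanGenerator n G) :
    ∃ c C : ℝ, 0 ≤ c ∧ IsMixtureProfile n (bregman G) fun q => C - c * Real.log q := by
  obtain ⟨c, C, hc, hlog⟩ := (hψ.isBinaryProper hn hG).exists_eq_log
  refine ⟨c, C, hc, fun P hP R hR hPR q hq => ?_⟩
  rw [hψ P hP R hR hPR q hq, hlog q hq]

theorem log_bregman_apply (hlog : IsMixtureProfile n (bregman G) fun q => C - c * Real.log q)
    (hn : 2 ≤ n) (hG : IsBregmanGenerator n G) (hP : P ∈ probSimplex n)
    (hQ : Q ∈ probSimplexPos n) : bregman G P Q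
      = ((G P - vertexInterpolation G P + C - c * ∑ i, P i * Real.log (Q i) : ℝ) : EReal) := by
  rw [hlog.bregman_apply hn hG hP hQ]
  simp only [mul_sub, Finset.sum_sub_distrib, ← Finset.sum_mul, hP.2, one_mul, Finset.mul_sum,
    mul_left_comm, add_sub_assoc]

theorem log_eq_of_mem_probSimplexPos
    (hlog : IsMixtureProfile n (bregman G) fun q => C - c * Real.log q)
    (hn : 2 ≤ n) (hG : IsBregmanGenerator n G) (hQ : Q ∈ probSimplexPos n) :
    G Q = vertexInterpolation G Q + c * negEntropy Q - C := by
  have h := (hlog.log_bregman_apply hn hG hQ.1 hQ).symm.trans (bregman_self G Q)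
  rw [EReal.coe_eq_zero, ← negEntropy] at h
  linarith

-- Off the support of `P` there is room for a law to mix with; the mixture is an interior point.
theorem log_eq_of_apply_eq_zero
    (hlog : IsMixtureProfile n (bregman G) fun q => C - c * Real.log q)
    (hn : 2 ≤ n) (hG : IsBregmanGenerator n G) (hP : P ∈ probSimplex n) {k : Fin n} (hk : P k = 0) :
    G P = vertexInterpolation G P + c * negEntropy P := by
  obtain ⟨R, hR, hRP⟩ := exists_mem_stdSimplex_eq_zero_iff (A := {x | P x ≠ 0})
    ((ne_univ_iff_exists_notMem _).2 ⟨k, by simpa using hk⟩)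
  have hhalf : (1 / 2 : ℝ) ∈ Ioo (0 : ℝ) 1 := by norm_num
  have hQ := mixture_mem_probSimplexPos hP hR
    (fun x => (ne_or_eq (P x) 0).imp_right fun hx => mt (hRP x).1 (not_not.2 hx)) hhalf
  have hsum : ∑ i, P i * Real.log (((1 / 2 : ℝ) • P + (1 - 1 / 2 : ℝ) • R) i)
      = Real.log (1 / 2) + negEntropy P := by
    have hterm : ∀ i, P i * Real.log (((1 / 2 : ℝ) • P + (1 - 1 / 2 : ℝ) • R) i)
        = P i * Real.log (1 / 2) + P i * Real.log (P i) := fun i => by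
      by_cases hi : P i = 0
      · simp only [hi, zero_mul, add_zero]
      · rw [Pi.add_apply, Pi.smul_apply, Pi.smul_apply, (hRP i).2 hi, smul_zero, add_zero,
          smul_eq_mul, Real.log_mul hhalf.1.ne' hi, mul_add]
    rw [Finset.sum_congr rfl fun i _ => hterm i, Finset.sum_add_distrib, ← Finset.sum_mul, hP.2,
      one_mul, negEntropy]
  have h := (hlog P hP R hR (fun x => (eq_or_ne (P x) 0).imp_right (hRP x).2) _ hhalf).symm.trans
    (hlog.log_bregman_apply hn hG hP hQ)
  rw [EReal.coe_eq_coe_iff, hsum] at h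
  linarith

-- The segment from `(e_i + e_j) / 2` to `e_i` lies in the boundary, where `C` does not enter `G`,
-- and yet `hlog` applies to its end points.
theorem log_const_eq_zero (hlog : IsMixtureProfile n (bregman G) fun q => C - c * Real.log q)
    (hn : 3 ≤ n) (hc : 0 ≤ c) (hG : IsBregmanGenerator n G) : C = 0 := by
  obtain ⟨i, j, k, hij, hik, hjk⟩ := Fintype.two_lt_card_iff.1
    (show 2 < Fintype.card (Fin n) by rwa [Fintype.card_fin])
  have hi : Pi.single i 1 ∈ probSimplex n := single_mem_stdSimplex ℝ i
  have hj : Pi.single j 1 ∈ probSimplex n := single_mem_stdSimplex ℝ j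
  have hhalf : (1 / 2 : ℝ) ∈ Ioo (0 : ℝ) 1 := by norm_num
  have hprofile := hlog _ hi _ hj (fun x => or_iff_not_imp_left.2 fun hx => ?_) _ hhalf
  · set Q : Fin n → ℝ := (1 / 2 : ℝ) • Pi.single i 1 + (1 - 1 / 2 : ℝ) • Pi.single j 1 with hQdef
    have hQ : Q ∈ probSimplex n :=
      convex_stdSimplex ℝ (Fin n) hi hj hhalf.1.le (by norm_num) (by norm_num)
    have hQi : Q i = 1 / 2 := by simp [hQdef, hij]
    have hboundary : EqOn G (⇑(vertexInterpolation G) + c • negEntropy)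
        (segment ℝ Q (Pi.single i 1)) := fun P hP => by
      refine hlog.log_eq_of_apply_eq_zero (by lia) hG
        ((convex_stdSimplex ℝ (Fin n)).segment_subset hQ hi hP) (k := k) ?_
      obtain ⟨a, b, -, -, -, rfl⟩ := hP
      simp [hQdef, hik.symm, hjk.symm]
    rw [bregman_eq_mul_klDivergence hc hi hQ hboundary, klDivergence_single (by simp [hQi]), hQi,
      ← EReal.coe_mul, EReal.coe_eq_coe_iff] at hprofile
    linarith
  · obtain rfl : x = i := by_contra fun h => hx (Pi.single_eq_of_ne h 1)
    exact Pi.single_eq_of_ne hij 1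

end IsMixtureProfile

theorem exists_eqOn_add_smul_negEntropy (hn : 3 ≤ n) (hG : IsBregmanGenerator n G)
    (hD : SatisfiesSufficiency n (bregman G)) :
    ∃ c : ℝ, 0 ≤ c ∧ EqOn G (⇑(vertexInterpolation G) + c • negEntropy) (probSimplex n) := by
  obtain ⟨ψ, hψ⟩ := exists_isMixtureProfile (by lia) hG hD
  obtain ⟨c, C, hc, hlog⟩ := hψ.exists_log hn hG
  refine ⟨c, hc, fun P hP => ?_⟩
  by_cases hpos : ∀ i, 0 < P i
  · simpa [hlog.log_const_eq_zero hn hc hG] using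
      hlog.log_eq_of_mem_probSimplexPos (by lia) hG ⟨hP, hpos⟩
  · push Not at hpos
    obtain ⟨k, hk⟩ := hpos
    exact hlog.log_eq_of_apply_eq_zero (by lia) hG hP (hk.antisymm (hP.1 k))

end MixtureProfile

theorem theorem4 :
    (∀ n : ℕ, 3 ≤ n → ∀ G : (Fin n → ℝ) → ℝ, IsBregmanGenerator n G →
      SatisfiesSufficiency n (bregman G) →
        ∃ c : ℝ, 0 ≤ c ∧ ∀ P ∈ probSimplex n, ∀ Q ∈ probSimplex n,
          bregman G P Q = (c : EReal) * klDivergence P Q) ∧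
    (∀ G : (Fin 2 → ℝ) → ℝ, IsBregmanGenerator 2 G →
      (SatisfiesSufficiency 2 (bregman G) ↔
        ∃ S : (Fin 2 → ℝ) → ℝ, IsBregmanGenerator 2 S ∧ IsSymmetricOnSimplex 2 S ∧
          ∀ P ∈ probSimplex 2, ∀ Q ∈ probSimplex 2, bregman G P Q = bregman S P Q)) := by
  refine ⟨fun n hn G hG hD => ?_, fun G hG => satisfiesSufficiency_two_iff hG⟩
  obtain ⟨c, hc, hGc⟩ := exists_eqOn_add_smul_negEntropy hn hG hD
  refine ⟨c, hc, fun P hP Q hQ => bregman_eq_mul_klDivergence hc hP hQ (hGc.mono ?_)⟩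
  exact (convex_stdSimplex ℝ (Fin n)).segment_subset hQ hP
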